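/- Fix a constant $\kappa>0$. There are constants $\bar A,C,c>0$, depending only on $\kappa$, such that for all $A\ge\bar A$ and $A_0>A$ there is a constant $K>0$, depending only on $\kappa,A,A_0$, for which the following holds. Let $n,m,p\ge1$, $\sigma>0$, let $X\in\mathbb R^{n\times p}$ and $B^*\in\mathbb R^{p\times m}$ be deterministic, and let $Y=XB^*+\mathcal E$, where the entries $\epsilon_{i,k}$ of the random matrix $\mathcal E\in\mathbb R^{n\times m}$ are independent and satisfy $\mathbb E\,\epsilon_{i,k}=0$, $\|\epsilon_{i,k}\|_{\psi_2}:=\inf\{t>0:\mathbb E\exp(\epsilon_{i,k}^2/t^2)\le2\}\le\sigma$ and $\mathbb E\,\epsilon_{i,k}^2\ge\kappa\sigma^2$. For $B\in\mathbb R^{p\times m}$ let $J(B)$ be the number of nonzero rows of $B$, let $$P(B)=J(B)\,m+J(B)\log\{ep/J(B)\}\quad(P(B)=0\text{ if }J(B)=0),\qquad \delta(B)=\frac{A\,P(B)}{mn},$$ and put $s^*=J(B^*)$ and $\mathbf D_2(M,N)=\tfrac12\|M-N\|_F^2$. Assume $P(B^*)\le mn/A_0$. Then, with probability at least $1-Cp^{-c}e^{-cm}-Ce^{-cmn}$,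 every $\hat B$ that minimizes $$\log\|Y-XB\|_F^2+\delta(B)\quad\text{subject to }B\in\mathbb R^{p\times m},\ \delta(B)<1$$ (with the convention $\log 0=-\infty$) satisfies $$\mathbf D_2(X\hat B,XB^*)\le K\sigma^2\{s^*m+s^*\log(ep/s^*)\},$$ where the right-hand side is $0$ if $s^*=0$. -/

import Mathlib

open MeasureTheory ProbabilityTheory

namespace PredictiveIC

noncomputable section

open scoped Matrix.Norms.Frobenius in
/-- The squared Frobenius norm of a real matrix. -/
def frobSq {n m : ℕ} (M : Matrix (Fin n) (Fin m) ℝ) : ℝ := ‖M‖ ^ 2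

open scoped Matrix.Norms.Frobenius in
theorem frobSq_eq_sum {n m : ℕ} (M : Matrix (Fin n) (Fin m) ℝ) :
    frobSq M = ∑ i, ∑ k, M i k ^ 2 := by
  have h : 0 ≤ ∑ i, ∑ k, M i k ^ 2 :=
    Finset.sum_nonneg fun i _ => Finset.sum_nonneg fun k _ => sq_nonneg _
  unfold frobSq
  rw [Matrix.frobenius_norm_def, ← Real.sqrt_eq_rpow]
  simp only [Real.rpow_two, Real.norm_eq_abs, sq_abs]
  exact Real.sq_sqrt h

/-- `D₂(M, N) = ‖M - N‖_F² / 2`. -/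
def D₂ {n m : ℕ} (M N : Matrix (Fin n) (Fin m) ℝ) : ℝ := frobSq (M - N) / 2

/-- `J(B)`, the number of nonzero rows of `B`. -/
def rowSupportCard {p m : ℕ} (B : Matrix (Fin p) (Fin m) ℝ) : ℕ :=
  {j : Fin p | B j ≠ 0}.ncard

/-- The complexity `J m + J log (e p / J)` of a model with `J` nonzero rows;
it is `0` for `J = 0`. -/
def complexity (p m J : ℕ) : ℝ :=
  (J : ℝ) * m + J * Real.log (Real.exp 1 * p / J)

/-- The penalty `P(B) = J(B) m + J(B) log (e p / J(B))`. -/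
def penalty {p m : ℕ} (B : Matrix (Fin p) (Fin m) ℝ) : ℝ :=
  complexity p m (rowSupportCard B)

/-- `δ(B) = A P(B) / (m n)`, where `n` is the sample size. -/
def scaledPenalty (A : ℝ) (n : ℕ) {p m : ℕ} (B : Matrix (Fin p) (Fin m) ℝ) : ℝ :=
  A * penalty B / (m * n)

/-- The scale-free criterion `log ‖X B - Y‖_F² + A P(B) / (m n)`, with values in the
extended reals so that `log 0 = -∞`. -/
def logCriterion (A : ℝ) {n p m : ℕ} (X : Matrix (Fin n) (Fin p) ℝ)
    (Y : Matrix (Fin n) (Fin m) ℝ) (B : Matrix (Fin p) (Fin m) ℝ) : EReal :=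
  ENNReal.log (ENNReal.ofReal (frobSq (X * B - Y))) + ((scaledPenalty A n B : ℝ) : EReal)

/-- `B` minimizes the scale-free criterion over all matrices `B'` with `δ(B') < 1`. -/
def IsSelected (A : ℝ) {n p m : ℕ} (X : Matrix (Fin n) (Fin p) ℝ)
    (Y : Matrix (Fin n) (Fin m) ℝ) (B : Matrix (Fin p) (Fin m) ℝ) : Prop :=
  scaledPenalty A n B < 1 ∧
    IsMinOn (logCriterion A X Y) {B' | scaledPenalty A n B' < 1} B

/-- The `ψ₂`-norm `inf {t > 0 : E exp (ξ² / t²) ≤ 2}`; it is `∞` when there is no such `t`. -/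
def psi2Norm {Ω : Type*} [MeasurableSpace Ω] (μ : Measure Ω) (ξ : Ω → ℝ) : ENNReal :=
  ⨅ (t : ℝ) (_ : 0 < t ∧ ∫⁻ ω, ENNReal.ofReal (Real.exp (ξ ω ^ 2 / t ^ 2)) ∂μ ≤ 2),
    ENNReal.ofReal t

/-- A centered real random variable whose `ψ₂`-norm is at most `σ`. -/
structure IsSubGaussian {Ω : Type*} [MeasurableSpace Ω] (μ : Measure Ω) (ξ : Ω → ℝ)
    (σ : ℝ) : Prop where
  measurable : Measurable ξ
  mean_zero : ∫ ω, ξ ω ∂μ = 0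
  scale_le : psi2Norm μ ξ ≤ ENNReal.ofReal σ

end

end PredictiveIC

namespace PredictiveIC

/-! Comparing $\hat B$ with $B^*$, which is feasible because $A<A_0$, and exponentiating the
criterion gives $\|X\hat B-Y\|^2\le\|\mathcal E\|^2e^{\delta^*-\hat\delta}$
(`IsSelected.frobSq_le`). Both penalties lie in $[0,1]$, so the exponential is at most
$1+2\delta^*-\hat\delta/2$ (`exp_sub_le`). Thus $\|\mathcal E\|^2$ itself acts as the noise level,
and $\sigma$ need not be known.

With $d=X(\hat B-B^*)$, expanding the square leaves the cross term $\langle d,\mathcal E\rangle$. It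
sees only the projection of $\mathcal E$ on the model space of the union of the two supports
(`norm_sq_le_of_norm_sub_sq_le`). Its cost, at most $256\sigma^2(\hat P+P^*)$ by subadditivity of
the complexity, is paid by the term $-\|\mathcal E\|^2\hat\delta/2$ once $\|\mathcal
E\|^2\gtrsim\kappa\sigma^2mn$ and $A\ge1024/\kappa$. What remains is a multiple of $\sigma^2P^*$
(`IsSelected.D₂_le`).

The probability lies in `exists_noise_event`: Chernoff bounds put $\|\mathcal E\|^2$ between
multiples of $\sigma^2mn$, and a union bound over supports controls all projections at once. -/

theorem exp_le_add_exp_sq (x : ℝ) : Real.exp x ≤ x + Real.exp (x ^ 2) := by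
  have h2 := Real.add_one_le_exp (x ^ 2)
  rcases le_or_gt |x| 1 with h | h
  · have := (abs_le.1 (Real.abs_exp_sub_one_sub_id_le h)).2
    linarith
  · rcases lt_abs.1 h with h | h
    · have : Real.exp x ≤ Real.exp (x ^ 2) := Real.exp_le_exp.2 (by nlinarith)
      linarith
    · have : Real.exp x ≤ 1 := Real.exp_le_one_iff.2 (by linarith)
      nlinarith

theorem exp_mul_le_of_mem_Icc {θ : ℝ} (h0 : 0 ≤ θ) (h1 : θ ≤ 1) (y : ℝ) :
    Real.exp (θ * y) ≤ 1 - θ + θ * Real.exp y := by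
  have := convexOn_exp.2 (Set.mem_univ (0 : ℝ)) (Set.mem_univ y) (sub_nonneg.2 h1) h0 (by ring)
  simpa using this

theorem exp_neg_le_quadratic {x : ℝ} (hx : 0 ≤ x) : Real.exp (-x) ≤ 1 - x + x ^ 2 := by
  rcases le_or_gt x 1 with h1 | h1
  · have := (abs_le.1 (Real.abs_exp_sub_one_sub_id_le (x := -x)
      (abs_le.2 ⟨by linarith, by linarith⟩))).2
    nlinarith
  · have : Real.exp (-x) ≤ 1 := Real.exp_le_one_iff.2 (by linarith)
    nlinarith

/-! ### Exponential moments of one sub-Gaussian variable -/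

section OneVariable

variable {Ω : Type*} [MeasurableSpace Ω] {μ : Measure Ω} {ξ : Ω → ℝ} {σ : ℝ}

theorem IsSubGaussian.lintegral_exp_sq_le (h : IsSubGaussian μ ξ σ) (hσ : 0 < σ) :
    ∫⁻ ω, ENNReal.ofReal (Real.exp (ξ ω ^ 2 / (2 * σ) ^ 2)) ∂μ ≤ 2 := by
  -- The infimum defining the norm may not be attained at $\sigma$; doubling the scale leaves room
  -- for an admissible $t<2\sigma$.
  have h1 : psi2Norm μ ξ < ENNReal.ofReal (2 * σ) :=
    h.scale_le.trans_lt ((ENNReal.ofReal_lt_ofReal_iff (by positivity)).2 (by linarith))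
  simp only [psi2Norm, iInf_lt_iff] at h1
  obtain ⟨t, ⟨ht, hle⟩, hlt⟩ := h1
  have htσ : t < 2 * σ := (ENNReal.ofReal_lt_ofReal_iff (by positivity)).1 hlt
  refine (lintegral_mono fun ω => ENNReal.ofReal_le_ofReal (Real.exp_le_exp.2 ?_)).trans hle
  gcongr

theorem IsSubGaussian.integrable_exp_sq (h : IsSubGaussian μ ξ σ) (hσ : 0 < σ) :
    Integrable (fun ω => Real.exp (ξ ω ^ 2 / (2 * σ) ^ 2)) μ := by
  have := h.measurable
  refine ⟨by fun_prop, ?_⟩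
  rw [hasFiniteIntegral_iff_ofReal (Filter.Eventually.of_forall fun ω => (Real.exp_pos _).le)]
  exact (h.lintegral_exp_sq_le hσ).trans_lt (by simp)

theorem IsSubGaussian.integral_exp_sq_le (h : IsSubGaussian μ ξ σ) (hσ : 0 < σ) :
    ∫ ω, Real.exp (ξ ω ^ 2 / (2 * σ) ^ 2) ∂μ ≤ 2 := by
  rw [integral_eq_lintegral_of_nonneg_ae (Filter.Eventually.of_forall fun ω => (Real.exp_pos _).le)
    (h.integrable_exp_sq hσ).1]
  exact ENNReal.toReal_le_of_le_ofReal (by norm_num) (by simpa using h.lintegral_exp_sq_le hσ)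

theorem IsSubGaussian.integrable_sq (h : IsSubGaussian μ ξ σ) (hσ : 0 < σ) :
    Integrable (fun ω => ξ ω ^ 2) μ := by
  have := h.measurable
  refine ((h.integrable_exp_sq hσ).const_mul ((2 * σ) ^ 2)).mono' (by fun_prop)
    (Filter.Eventually.of_forall fun ω => ?_)
  have h2 : ξ ω ^ 2 = (2 * σ) ^ 2 * (ξ ω ^ 2 / (2 * σ) ^ 2) := by field_simp
  rw [Real.norm_of_nonneg (sq_nonneg _)]
  nth_rewrite 1 [h2]
  gcongr
  linarith [Real.add_one_le_exp (ξ ω ^ 2 / (2 * σ) ^ 2)]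

theorem IsSubGaussian.integrable [IsProbabilityMeasure μ]
    (h : IsSubGaussian μ ξ σ) (hσ : 0 < σ) : Integrable ξ μ := by
  have := h.measurable
  refine ((h.integrable_sq hσ).add (integrable_const (1 : ℝ))).mono' (by fun_prop)
    (Filter.Eventually.of_forall fun ω => ?_)
  simp only [Real.norm_eq_abs, Pi.add_apply]
  rw [← sq_abs]
  nlinarith [sq_nonneg (|ξ ω| - 1), abs_nonneg (ξ ω)]

theorem lintegral_ofReal_le_of_le {f g : Ω → ℝ} {b : ℝ} (hg : Integrable g μ)
    (hfg : ∀ ω, f ω ≤ g ω) (h0 : ∀ ω, 0 ≤ f ω) (hb : ∫ ω, g ω ∂μ ≤ b) :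
    ∫⁻ ω, ENNReal.ofReal (f ω) ∂μ ≤ ENNReal.ofReal b := by
  calc ∫⁻ ω, ENNReal.ofReal (f ω) ∂μ ≤ ∫⁻ ω, ENNReal.ofReal (g ω) ∂μ :=
        lintegral_mono fun ω => ENNReal.ofReal_le_ofReal (hfg ω)
    _ = ENNReal.ofReal (∫ ω, g ω ∂μ) :=
        (ofReal_integral_eq_lintegral_ofReal hg
          (Filter.Eventually.of_forall fun ω => (h0 ω).trans (hfg ω))).symm
    _ ≤ _ := ENNReal.ofReal_le_ofReal hb

/-- The moment generating function of a centered sub-Gaussian variable. -/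
theorem IsSubGaussian.lintegral_exp_mul_le [IsProbabilityMeasure μ]
    (h : IsSubGaussian μ ξ σ) (hσ : 0 < σ) (l : ℝ) :
    ∫⁻ ω, ENNReal.ofReal (Real.exp (l * ξ ω)) ∂μ ≤
      ENNReal.ofReal (Real.exp (4 * σ ^ 2 * l ^ 2)) := by
  have hi := h.integrable_exp_sq hσ
  have hle := h.integral_exp_sq_le hσ
  set θ := 4 * σ ^ 2 * l ^ 2 with hθ
  have hθ0 : 0 ≤ θ := by positivity
  -- For small $\theta$ the linear term integrates to zero and convexity leaves $1+\theta$. For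
  -- large $\theta$ centering is not needed: Young's inequality gives $e^{\theta/2}\cdot\frac32\le
  -- e^\theta$.
  rcases le_or_gt θ 1 with h1 | h1
  · have hi' := (h.integrable hσ).const_mul l
    have hs : Integrable (fun ω => 1 - θ + θ * Real.exp (ξ ω ^ 2 / (2 * σ) ^ 2)) μ :=
      (integrable_const _).add (hi.const_mul θ)
    refine lintegral_ofReal_le_of_le
      (g := fun ω => l * ξ ω + (1 - θ + θ * Real.exp (ξ ω ^ 2 / (2 * σ) ^ 2)))
      (hi'.add hs) (fun ω => ?_)
      (fun ω => (Real.exp_pos _).le) ?_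
    · refine (exp_le_add_exp_sq _).trans ?_
      have := exp_mul_le_of_mem_Icc hθ0 h1 (ξ ω ^ 2 / (2 * σ) ^ 2)
      have e : θ * (ξ ω ^ 2 / (2 * σ) ^ 2) = (l * ξ ω) ^ 2 := by rw [hθ]; field_simp; ring
      rw [e] at this
      linarith
    · rw [integral_add hi' hs,
        integral_add (integrable_const _) (hi.const_mul θ), integral_const_mul, integral_const_mul,
        h.mean_zero]
      simp only [integral_const, probReal_univ, smul_eq_mul]
      nlinarith [Real.add_one_le_exp θ]
  · refine lintegral_ofReal_le_of_le
      (g := fun ω => Real.exp (θ / 2) * (1 / 2 + 1 / 2 * Real.exp (ξ ω ^ 2 / (2 * σ) ^ 2)))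
      (((integrable_const _).add (hi.const_mul _)).const_mul _) (fun ω => ?_)
      (fun ω => (Real.exp_pos _).le) ?_
    · have := exp_mul_le_of_mem_Icc (θ := 1 / 2) (by norm_num) (by norm_num) (ξ ω ^ 2 / (2 * σ) ^ 2)
      calc Real.exp (l * ξ ω)
          ≤ Real.exp (θ / 2 + 1 / 2 * (ξ ω ^ 2 / (2 * σ) ^ 2)) := by
            refine Real.exp_le_exp.2 ?_
            have e2 : l * ξ ω = (2 * σ * l) * (ξ ω / (2 * σ)) := by field_simp
            rw [e2, ← div_pow, hθ]
            nlinarith [sq_nonneg (2 * σ * l - ξ ω / (2 * σ))]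
        _ ≤ _ := by
            rw [Real.exp_add]
            gcongr
            linarith
    · rw [integral_const_mul, integral_add (integrable_const _) (hi.const_mul _),
        integral_const_mul]
      simp only [integral_const, probReal_univ, smul_eq_mul]
      have e : Real.exp θ = Real.exp (θ / 2) * Real.exp (θ / 2) := by
        rw [← Real.exp_add]; ring_nf
      rw [e]
      gcongr
      linarith [Real.add_one_le_exp (θ / 2)]

/-- The Laplace transform of the square of a non-degenerate sub-Gaussian variable. -/
theorem IsSubGaussian.lintegral_exp_neg_sq_le [IsProbabilityMeasure μ]
    (h : IsSubGaussian μ ξ σ) (hσ : 0 < σ) {κ η : ℝ}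
    (hη : 0 ≤ η) (hκ : κ * σ ^ 2 ≤ ∫ ω, ξ ω ^ 2 ∂μ) :
    ∫⁻ ω, ENNReal.ofReal (Real.exp (-(η / σ ^ 2 * ξ ω ^ 2))) ∂μ ≤
      ENNReal.ofReal (Real.exp (-(η * κ) + 64 * η ^ 2)) := by
  have hi := h.integrable_exp_sq hσ
  have hle := h.integral_exp_sq_le hσ
  have hi2 := (h.integrable_sq hσ).const_mul (-(η / σ ^ 2))
  have hs : Integrable (fun ω => 1 + 32 * η ^ 2 * Real.exp (ξ ω ^ 2 / (2 * σ) ^ 2)) μ :=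
    (integrable_const _).add (hi.const_mul _)
  refine lintegral_ofReal_le_of_le
    (g := fun ω => -(η / σ ^ 2) * ξ ω ^ 2 +
      (1 + 32 * η ^ 2 * Real.exp (ξ ω ^ 2 / (2 * σ) ^ 2)))
    (hi2.add hs) (fun ω => ?_)
    (fun ω => (Real.exp_pos _).le) ?_
  · have h1 := exp_neg_le_quadratic (x := η / σ ^ 2 * ξ ω ^ 2) (by positivity)
    have h2 := Real.quadratic_le_exp_of_nonneg (x := ξ ω ^ 2 / (2 * σ) ^ 2) (by positivity)
    have h3 : (η / σ ^ 2 * ξ ω ^ 2) ^ 2 = 32 * η ^ 2 * ((ξ ω ^ 2 / (2 * σ) ^ 2) ^ 2 / 2) := by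
      field_simp; ring
    have h4 : 0 ≤ ξ ω ^ 2 / (2 * σ) ^ 2 := by positivity
    have h5 : 32 * η ^ 2 * ((ξ ω ^ 2 / (2 * σ) ^ 2) ^ 2 / 2) ≤
        32 * η ^ 2 * Real.exp (ξ ω ^ 2 / (2 * σ) ^ 2) := by
      gcongr
      linarith
    linarith
  · rw [integral_add hi2 hs,
      integral_add (integrable_const _) (hi.const_mul _), integral_const_mul, integral_const_mul]
    simp only [integral_const, probReal_univ, smul_eq_mul]
    have h1 : η / σ ^ 2 * (κ * σ ^ 2) ≤ η / σ ^ 2 * ∫ ω, ξ ω ^ 2 ∂μ := by gcongr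
    have h2 : η / σ ^ 2 * (κ * σ ^ 2) = η * κ := by field_simp
    have h3 : 32 * η ^ 2 * ∫ ω, Real.exp (ξ ω ^ 2 / (2 * σ) ^ 2) ∂μ ≤ 32 * η ^ 2 * 2 := by gcongr
    have := Real.add_one_le_exp (-(η * κ) + 64 * η ^ 2)
    linarith

end OneVariable

/-! ### Gaussian linearization of a squared norm -/

section Gaussian

theorem lintegral_exp_mul_gaussian (a : ℝ) :
    ∫⁻ g, ENNReal.ofReal (Real.exp (a * g)) ∂(gaussianReal 0 1) =
      ENNReal.ofReal (Real.exp (a ^ 2 / 2)) := by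
  rw [← ofReal_integral_eq_lintegral_ofReal (integrable_exp_mul_gaussianReal a)
    (Filter.Eventually.of_forall fun _ => (Real.exp_pos _).le)]
  have h := congrFun (mgf_id_gaussianReal (μ := 0) (v := 1)) a
  simp only [mgf, id] at h
  rw [h]
  simp

theorem lintegral_exp_sq_gaussian_le :
    ∫⁻ g, ENNReal.ofReal (Real.exp (g ^ 2 / 4)) ∂(gaussianReal 0 1) ≤
      ENNReal.ofReal (Real.exp (1 / 2)) := by
  rw [gaussianReal_of_var_ne_zero _ one_ne_zero,
    lintegral_withDensity_eq_lintegral_mul _ (measurable_gaussianPDF 0 1) (by fun_prop)]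
  have h1 : ∀ g : ℝ, (gaussianPDF 0 1 * fun g => ENNReal.ofReal (Real.exp (g ^ 2 / 4))) g =
      ENNReal.ofReal ((√(2 * Real.pi))⁻¹ * Real.exp (-(1 / 4) * g ^ 2)) := fun g => by
    simp only [Pi.mul_apply, gaussianPDF, gaussianPDFReal]
    rw [← ENNReal.ofReal_mul (by positivity), mul_assoc, ← Real.exp_add]
    congr 3
    · simp
    · simp; ring
  simp_rw [h1]
  rw [← ofReal_integral_eq_lintegral_ofReal
    ((integrable_exp_neg_mul_sq (by norm_num)).const_mul _)
    (Filter.Eventually.of_forall fun _ => by positivity), integral_const_mul, integral_gaussian]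
  refine ENNReal.ofReal_le_ofReal ?_
  rw [← Real.sqrt_inv, ← Real.sqrt_mul (by positivity), Real.sqrt_le_left (by positivity),
    ← Real.exp_nat_mul]
  have h2 : (2 * Real.pi)⁻¹ * (Real.pi / (1 / 4)) = 2 := by field_simp; norm_num
  rw [h2]
  have := Real.add_one_le_exp 1
  norm_num at this ⊢
  linarith

theorem lintegral_pi_prod {ι : Type*} [Fintype ι] {ν : Measure ℝ} [IsProbabilityMeasure ν]
    {F : ι → ℝ → ENNReal} (hF : ∀ i, Measurable (F i)) :
    ∫⁻ x, ∏ i, F i (x i) ∂(Measure.pi fun _ : ι => ν) = ∏ i, ∫⁻ g, F i g ∂ν := by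
  rw [lintegral_prod_eq_prod_lintegral_of_indepFun Finset.univ
    (fun i (x : ι → ℝ) => F i (x i)) (iIndepFun_pi fun i => (hF i).aemeasurable)
    (fun i => (hF i).comp (measurable_pi_apply i))]
  refine Finset.prod_congr rfl fun i _ => ?_
  exact (measurePreserving_eval (fun _ : ι => ν) i).lintegral_comp (hF i)

theorem ofReal_exp_sum {ι : Type*} (s : Finset ι) (f : ι → ℝ) :
    ENNReal.ofReal (Real.exp (∑ i ∈ s, f i)) = ∏ i ∈ s, ENNReal.ofReal (Real.exp (f i)) := by
  rw [Real.exp_sum, ENNReal.ofReal_prod_of_nonneg fun _ _ => (Real.exp_pos _).le]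

/-- A jointly sub-Gaussian vector has an exponentially integrable squared norm. -/
theorem lintegral_exp_sum_sq_le {Ω ι : Type*} [MeasurableSpace Ω] [Fintype ι] {μ : Measure Ω}
    [SFinite μ] {Y : ι → Ω → ℝ} (hY : ∀ j, Measurable (Y j)) {σ : ℝ} (hσ : 0 < σ)
    (h : ∀ a : ι → ℝ, ∫⁻ ω, ENNReal.ofReal (Real.exp (∑ j, a j * Y j ω)) ∂μ ≤
      ENNReal.ofReal (Real.exp (4 * σ ^ 2 * ∑ j, a j ^ 2))) :
    ∫⁻ ω, ENNReal.ofReal (Real.exp ((∑ j, Y j ω ^ 2) / (32 * σ ^ 2))) ∂μ ≤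
      ENNReal.ofReal (Real.exp (Fintype.card ι / 2)) := by
  set γ := Measure.pi fun _ : ι => gaussianReal 0 1
  calc ∫⁻ ω, ENNReal.ofReal (Real.exp ((∑ j, Y j ω ^ 2) / (32 * σ ^ 2))) ∂μ
      -- An auxiliary standard Gaussian $g$ makes the exponent linear in $Y$, so the hypothesis
      -- applies after swapping integrals. The scale $4\sigma$ leaves $e^{\|g\|^2/4}$, which is
      -- integrable.
      = ∫⁻ ω, ∫⁻ g, ENNReal.ofReal (Real.exp (∑ j, Y j ω / (4 * σ) * g j)) ∂γ ∂μ := by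
        refine lintegral_congr fun ω => ?_
        simp_rw [ofReal_exp_sum]
        rw [lintegral_pi_prod (F := fun j g => ENNReal.ofReal (Real.exp (Y j ω / (4 * σ) * g)))
          fun i => by fun_prop, Finset.sum_div, ofReal_exp_sum]
        refine Finset.prod_congr rfl fun j _ => ?_
        rw [lintegral_exp_mul_gaussian]
        congr 2
        field_simp
        ring
    _ = ∫⁻ g, ∫⁻ ω, ENNReal.ofReal (Real.exp (∑ j, Y j ω / (4 * σ) * g j)) ∂μ ∂γ := by
        refine lintegral_lintegral_swap (Measurable.aemeasurable ?_)
        have h1 : ∀ j, Measurable fun x : Ω × (ι → ℝ) => Y j x.1 := fun j =>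
          (hY j).comp measurable_fst
        have h2 : ∀ j, Measurable fun x : Ω × (ι → ℝ) => x.2 j := fun j =>
          (measurable_pi_apply j).comp measurable_snd
        simp only [Function.uncurry_def]
        fun_prop
    _ ≤ ∫⁻ g, ENNReal.ofReal (Real.exp (∑ j, g j ^ 2 / 4)) ∂γ := by
        refine lintegral_mono fun g => ?_
        have h1 := h fun j => g j / (4 * σ)
        have e1 : ∀ ω, ∑ j, Y j ω / (4 * σ) * g j = ∑ j, g j / (4 * σ) * Y j ω := fun ω =>
          Finset.sum_congr rfl fun j _ => by ring
        have e2 : 4 * σ ^ 2 * ∑ j, (g j / (4 * σ)) ^ 2 = ∑ j, g j ^ 2 / 4 := by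
          rw [Finset.mul_sum]
          refine Finset.sum_congr rfl fun j _ => ?_
          field_simp
        simp_rw [e1]
        rwa [e2] at h1
    _ = ∏ _j : ι, ∫⁻ g, ENNReal.ofReal (Real.exp (g ^ 2 / 4)) ∂(gaussianReal 0 1) := by
        simp_rw [ofReal_exp_sum]
        exact lintegral_pi_prod (F := fun _ g => ENNReal.ofReal (Real.exp (g ^ 2 / 4)))
          fun i => by fun_prop
    _ ≤ ∏ _j : ι, ENNReal.ofReal (Real.exp (1 / 2)) :=
        Finset.prod_le_prod' fun _ _ => lintegral_exp_sq_gaussian_le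
    _ = ENNReal.ofReal (Real.exp (Fintype.card ι / 2)) := by
        rw [← ofReal_exp_sum]
        simp [div_eq_mul_inv]

end Gaussian

/-! ### Tail bounds for the noise and its projections -/

section Tails

variable {Ω : Type*} [MeasurableSpace Ω] {μ : Measure Ω}

theorem measure_ge_le_exp {f : Ω → ℝ} (hf : Measurable f) {b : ℝ}
    (h : ∫⁻ ω, ENNReal.ofReal (Real.exp (f ω)) ∂μ ≤ ENNReal.ofReal (Real.exp b)) (a : ℝ) :
    μ {ω | a ≤ f ω} ≤ ENNReal.ofReal (Real.exp (b - a)) := by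
  have h1 := meas_ge_le_lintegral_div (μ := μ)
    (f := fun ω => ENNReal.ofReal (Real.exp (f ω))) (by fun_prop) (ε := ENNReal.ofReal (Real.exp a))
    (by simp [Real.exp_pos]) (by simp)
  have h2 : {ω | a ≤ f ω} =
      {ω | ENNReal.ofReal (Real.exp a) ≤ ENNReal.ofReal (Real.exp (f ω))} := by
    ext ω
    simp [ENNReal.ofReal_le_ofReal_iff (Real.exp_pos (f ω)).le]
  rw [h2, Real.exp_sub, ENNReal.ofReal_div_of_pos (Real.exp_pos a)]
  exact h1.trans (ENNReal.div_le_div_right h _)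

variable {ι : Type*} [Fintype ι] {ε : ι → Ω → ℝ} {σ : ℝ}

theorem lintegral_exp_sum_le (hind : iIndepFun ε μ) {φ : ι → ℝ → ℝ} (hφ : ∀ i, Measurable (φ i))
    (hε : ∀ i, Measurable (ε i)) {b : ι → ℝ}
    (h : ∀ i, ∫⁻ ω, ENNReal.ofReal (Real.exp (φ i (ε i ω))) ∂μ ≤ ENNReal.ofReal (Real.exp (b i))) :
    ∫⁻ ω, ENNReal.ofReal (Real.exp (∑ i, φ i (ε i ω))) ∂μ ≤
      ENNReal.ofReal (Real.exp (∑ i, b i)) := by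
  have hm : ∀ i, Measurable fun x => ENNReal.ofReal (Real.exp (φ i x)) := fun i => by
    have := hφ i
    fun_prop
  simp_rw [ofReal_exp_sum]
  rw [lintegral_prod_eq_prod_lintegral_of_indepFun Finset.univ
    (fun i ω => ENNReal.ofReal (Real.exp (φ i (ε i ω)))) (hind.comp _ hm)
    (fun i => (hm i).comp (hε i))]
  exact Finset.prod_le_prod' fun i _ => h i

theorem measure_sum_sq_ge_le (hind : iIndepFun ε μ) (hε : ∀ i, IsSubGaussian μ (ε i) σ)
    (hσ : 0 < σ) :
    μ {ω | 8 * σ ^ 2 * Fintype.card ι ≤ ∑ i, ε i ω ^ 2} ≤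
      ENNReal.ofReal (Real.exp (-Fintype.card ι)) := by
  have hm := fun i => (hε i).measurable
  have h1 := lintegral_exp_sum_le hind (φ := fun _ x => x ^ 2 / (2 * σ) ^ 2)
    (fun _ => by fun_prop) hm (b := fun _ => 1) fun i =>
      ((hε i).lintegral_exp_sq_le hσ).trans (by
        have := Real.add_one_le_exp 1
        rw [← ENNReal.ofReal_ofNat]
        exact ENNReal.ofReal_le_ofReal (by linarith))
  -- Each factor of the moment is at most $2\le e$, so a threshold of twice the number of entries
  -- leaves a net exponent of minus that number.
  have h2 := measure_ge_le_exp (by fun_prop) h1 (2 * Fintype.card ι)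
  refine le_of_eq_of_le ?_ (h2.trans_eq ?_)
  · congr 1
    ext ω
    simp only [Set.mem_ofPred_eq]
    rw [← Finset.sum_div, le_div_iff₀ (by positivity)]
    ring_nf
  · simp
    ring_nf

theorem measure_sum_sq_le_le [IsProbabilityMeasure μ] (hind : iIndepFun ε μ)
    (hε : ∀ i, IsSubGaussian μ (ε i) σ)
    (hσ : 0 < σ) {κ : ℝ} (hκ : 0 < κ) (hvar : ∀ i, κ * σ ^ 2 ≤ ∫ ω, ε i ω ^ 2 ∂μ) :
    μ {ω | ∑ i, ε i ω ^ 2 ≤ κ * σ ^ 2 * Fintype.card ι / 2} ≤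
      ENNReal.ofReal (Real.exp (-(κ ^ 2 / 1024) * Fintype.card ι)) := by
  have hm := fun i => (hε i).measurable
  -- The value $\eta=\kappa/256$ maximizes the rate $\eta\kappa/2-64\eta^2$, which becomes
  -- $\kappa^2/1024$.
  have h1 := lintegral_exp_sum_le hind (φ := fun _ x => -(κ / 256 / σ ^ 2 * x ^ 2))
    (fun _ => by fun_prop) hm fun i =>
      (hε i).lintegral_exp_neg_sq_le hσ (η := κ / 256) (by positivity) (hvar i)
  have h2 := measure_ge_le_exp (by fun_prop) h1 (-(κ ^ 2 / 512 * Fintype.card ι))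
  refine le_of_eq_of_le ?_ (h2.trans_eq ?_)
  · congr 1
    ext ω
    simp only [Set.mem_ofPred_eq]
    rw [Finset.sum_neg_distrib, neg_le_neg_iff, ← Finset.mul_sum, div_mul_eq_mul_div,
      div_le_iff₀ (by positivity)]
    constructor <;> intro h <;> nlinarith
  · congr 2
    simp
    ring

open scoped RealInnerProductSpace in
theorem lintegral_exp_inner_le [IsProbabilityMeasure μ] (hind : iIndepFun ε μ)
    (hε : ∀ i, IsSubGaussian μ (ε i) σ) (hσ : 0 < σ) (u : EuclideanSpace ℝ ι) :
    ∫⁻ ω, ENNReal.ofReal (Real.exp ⟪u, WithLp.toLp 2 fun i => ε i ω⟫) ∂μ ≤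
      ENNReal.ofReal (Real.exp (4 * σ ^ 2 * ‖u‖ ^ 2)) := by
  have hm := fun i => (hε i).measurable
  have h1 := lintegral_exp_sum_le hind (φ := fun i x => u i * x)
    (fun _ => by fun_prop) hm fun i => (hε i).lintegral_exp_mul_le hσ (u i)
  rw [← Finset.mul_sum] at h1
  rw [EuclideanSpace.real_norm_sq_eq]
  convert h1 using 6 with ω
  simp [PiLp.inner_apply, mul_comm]

open scoped RealInnerProductSpace in
/-- The tail of the projection of a sub-Gaussian noise vector on a subspace. -/
theorem measure_norm_sq_projection_ge_le [IsProbabilityMeasure μ] (hind : iIndepFun ε μ)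
    (hε : ∀ i, IsSubGaussian μ (ε i) σ) (hσ : 0 < σ) (V : Submodule ℝ (EuclideanSpace ℝ ι))
    (a : ℝ) :
    μ {ω | 32 * σ ^ 2 * a ≤ ‖V.starProjection (WithLp.toLp 2 fun i => ε i ω)‖ ^ 2} ≤
      ENNReal.ofReal (Real.exp (Module.finrank ℝ V / 2 - a)) := by
  have hm := fun i => (hε i).measurable
  let b := stdOrthonormalBasis ℝ V
  have hmx : Measurable fun ω => (WithLp.toLp 2 fun i => ε i ω : EuclideanSpace ℝ ι) :=
    (WithLp.measurable_toLp 2 (ι → ℝ)).comp (measurable_pi_lambda _ hm)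
  have hY : ∀ j, Measurable fun ω => ⟪(b j : EuclideanSpace ℝ ι), WithLp.toLp 2 fun i => ε i ω⟫ :=
    fun j => (measurable_const.inner hmx)
  -- Coordinates in an orthonormal basis of `V` may be dependent, but they are jointly sub-Gaussian
  -- with the same constant; only the dimension of `V` enters.
  have h1 := lintegral_exp_sum_sq_le (μ := μ) hY hσ fun c => by
    have h2 := lintegral_exp_inner_le hind hε hσ (∑ j, c j • (b j : EuclideanSpace ℝ ι))
    simp_rw [sum_inner, real_inner_smul_left] at h2
    have e : ‖∑ j, c j • (b j : EuclideanSpace ℝ ι)‖ ^ 2 = ∑ j, c j ^ 2 := by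
      have : ∑ j, c j • (b j : EuclideanSpace ℝ ι) = ((∑ j, c j • b j : V) : EuclideanSpace ℝ ι) := by
        simp
      rw [this, ← Submodule.coe_norm, ← b.sum_sq_inner_right]
      refine Finset.sum_congr rfl fun j _ => ?_
      rw [b.orthonormal.inner_right_fintype]
    rwa [e] at h2
  have h2 := measure_ge_le_exp (by fun_prop) h1 a
  refine le_of_eq_of_le ?_ (h2.trans_eq (by simp))
  congr 1
  ext ω
  simp only [Set.mem_ofPred_eq]
  have e : ‖V.starProjection (WithLp.toLp 2 fun i => ε i ω)‖ ^ 2 =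
      ∑ j, ⟪(b j : EuclideanSpace ℝ ι), WithLp.toLp 2 fun i => ε i ω⟫ ^ 2 := by
    rw [Submodule.starProjection_apply, ← Submodule.coe_norm, ← b.sum_sq_inner_right]
    refine Finset.sum_congr rfl fun j _ => ?_
    rw [Submodule.inner_orthogonalProjectionOnto_eq_of_mem_left]
  rw [e, le_div_iff₀ (by positivity)]
  ring_nf

end Tails

/-! ### The complexity function and the count of supports -/

section Complexity

variable {p m J : ℕ}

@[simp]
theorem complexity_zero : complexity p m 0 = 0 := by simp [complexity]

theorem complexity_eq (hp : 0 < p) (hJ : 0 < J) :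
    complexity p m J = J * m + J * (1 + Real.log p - Real.log J) := by
  have h1 : (0 : ℝ) < p := by exact_mod_cast hp
  have h2 : (0 : ℝ) < J := by exact_mod_cast hJ
  rw [complexity, Real.log_div (by positivity) (by positivity), Real.log_mul (by positivity)
    (by positivity), Real.log_exp]

theorem add_le_complexity (hJ : 0 < J) (hJp : J ≤ p) :
    (J : ℝ) * m + J ≤ complexity p m J := by
  have h2 : (0 : ℝ) < J := by exact_mod_cast hJ
  have h := Real.log_le_log h2 (Nat.cast_le.2 hJp)
  rw [complexity_eq (hJ.trans_le hJp) hJ]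
  nlinarith

theorem mul_le_complexity (hJp : J ≤ p) : (J : ℝ) * m ≤ complexity p m J := by
  rcases Nat.eq_zero_or_pos J with rfl | hJ
  · simp
  · have h := add_le_complexity (m := m) hJ hJp
    have : (0 : ℝ) ≤ J := J.cast_nonneg
    linarith

theorem complexity_nonneg (hJp : J ≤ p) : 0 ≤ complexity p m J :=
  (by positivity : (0 : ℝ) ≤ (J : ℝ) * m).trans (mul_le_complexity hJp)

/-- The map $J\mapsto J(1+\log(p/J))$ has derivative $\log(p/J)\ge0$ up to $J=p$; the discrete form
follows from $\log(b/a)\le b/a-1$. -/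
theorem complexity_mono {a b : ℕ} (hab : a ≤ b) (hb : b ≤ p) :
    complexity p m a ≤ complexity p m b := by
  rcases Nat.eq_zero_or_pos a with rfl | ha
  · simpa using complexity_nonneg hb
  have ha' : (0 : ℝ) < a := by exact_mod_cast ha
  have hb' : (0 : ℝ) < b := by exact_mod_cast ha.trans_le hab
  have hab' : (a : ℝ) ≤ b := by exact_mod_cast hab
  have hbp := Real.log_le_log hb' (Nat.cast_le.2 hb)
  have h1 := Real.log_le_sub_one_of_pos (div_pos hb' ha')
  rw [Real.log_div hb'.ne' ha'.ne', le_sub_iff_add_le, le_div_iff₀ ha'] at h1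
  rw [complexity_eq (ha.trans_le (hab.trans hb)) ha,
    complexity_eq (ha.trans_le (hab.trans hb)) (ha.trans_le hab)]
  have h2 : (a : ℝ) * m ≤ b * m := by gcongr
  nlinarith [mul_nonneg (sub_nonneg.2 hab') (sub_nonneg.2 hbp)]

theorem complexity_add_le {a b : ℕ} (hab : a + b ≤ p) :
    complexity p m (a + b) ≤ complexity p m a + complexity p m b := by
  rcases Nat.eq_zero_or_pos a with rfl | ha
  · simp
  rcases Nat.eq_zero_or_pos b with rfl | hb
  · simp
  have hp : 0 < p := by omega
  have ha' : (0 : ℝ) < a := by exact_mod_cast ha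
  have hb' : (0 : ℝ) < b := by exact_mod_cast hb
  rw [complexity_eq hp ha, complexity_eq hp hb, complexity_eq hp (by omega)]
  push_cast
  have h1 := Real.log_le_log ha' (by linarith : (a : ℝ) ≤ a + b)
  have h2 := Real.log_le_log hb' (by linarith : (b : ℝ) ≤ a + b)
  nlinarith

theorem choose_le_exp_complexity (hJ : 0 < J) (hJp : J ≤ p) :
    (p.choose J : ℝ) ≤ Real.exp (complexity p m J) := by
  have hp : (0 : ℝ) < p := by exact_mod_cast hJ.trans_le hJp
  have hJ' : (0 : ℝ) < J := by exact_mod_cast hJ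
  have h1 := Nat.choose_le_pow_div (α := ℝ) J p
  have h2 := Real.pow_div_factorial_le_exp (J : ℝ) hJ'.le J
  calc (p.choose J : ℝ) ≤ (p : ℝ) ^ J / J.factorial := h1
    _ = (p / J : ℝ) ^ J * ((J : ℝ) ^ J / J.factorial) := by
        rw [div_pow]; field_simp
    _ ≤ (p / J : ℝ) ^ J * Real.exp J := by gcongr
    _ = Real.exp (J * (1 + Real.log p - Real.log J)) := by
        rw [show (J : ℝ) * (1 + Real.log p - Real.log J) =
          J * Real.log (p / J) + J by rw [Real.log_div hp.ne' hJ'.ne']; ring, Real.exp_add,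
          Real.exp_nat_mul, Real.exp_log (by positivity)]
    _ ≤ Real.exp (complexity p m J) := by
        rw [complexity_eq (hJ.trans_le hJp) hJ]
        refine Real.exp_le_exp.2 (le_add_of_nonneg_left (by positivity))

/-- Of the three copies of the complexity, one absorbs the number of supports of size $J$, one gives
the summable $e^{-J}$, and one, by monotonicity down to $J=1$, gives $e^{-m}/p$. -/
theorem sum_exp_complexity_le (hp : 0 < p) :
    ∑ S : Finset (Fin p), (if S.card = 0 then 0 else Real.exp (-3 * complexity p m S.card)) ≤
      2 * ((p : ℝ)⁻¹ * Real.exp (-m)) := by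
  have hp' : (0 : ℝ) < p := by exact_mod_cast hp
  have h := Finset.sum_powerset_apply_card (x := (Finset.univ : Finset (Fin p)))
    (fun J => if J = 0 then 0 else Real.exp (-3 * complexity p m J))
  rw [Finset.powerset_univ] at h
  rw [h, Finset.card_fin]
  calc _ ≤ ∑ J ∈ Finset.range (p + 1), (1 / 2 : ℝ) ^ J * ((p : ℝ)⁻¹ * Real.exp (-m)) := by
        refine Finset.sum_le_sum fun J hJ => ?_
        have hJp : J ≤ p := by simpa [Nat.lt_succ_iff] using hJ
        rw [nsmul_eq_mul]
        split_ifs with h0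
        · rw [mul_zero]; positivity
        have hJ0 := Nat.pos_of_ne_zero h0
        have h1 : (J : ℝ) ≤ complexity p m J := by
          have := add_le_complexity (m := m) hJ0 hJp
          have : (0 : ℝ) ≤ (J : ℝ) * m := by positivity
          linarith
        have h2 : m + Real.log p ≤ complexity p m J := by
          have := complexity_mono (m := m) (Nat.one_le_iff_ne_zero.2 h0) hJp
          rw [complexity_eq hp one_pos] at this
          simp at this
          linarith
        have h3 : Real.exp (-1) ≤ 1 / 2 := by
          rw [Real.exp_neg, one_div]
          have := Real.add_one_le_exp 1
          gcongr
          linarith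
        calc (p.choose J : ℝ) * Real.exp (-3 * complexity p m J)
            ≤ Real.exp (complexity p m J) * Real.exp (-3 * complexity p m J) := by
              gcongr; exact choose_le_exp_complexity hJ0 hJp
          _ ≤ Real.exp (J * (-1) + (-Real.log p + -m)) := by
              rw [← Real.exp_add]
              exact Real.exp_le_exp.2 (by linarith)
          _ = Real.exp (-1) ^ J * ((p : ℝ)⁻¹ * Real.exp (-m)) := by
              rw [Real.exp_add, Real.exp_add, Real.exp_nat_mul, Real.exp_neg (Real.log p),
                Real.exp_log hp']
          _ ≤ _ := by gcongr
    _ ≤ _ := by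
        rw [← Finset.sum_mul]
        gcongr
        exact sum_geometric_two_le _

end Complexity

/-! ### Model spaces and row supports -/

section Model

variable {n m p : ℕ}

/-- A matrix as a Euclidean vector. -/
noncomputable def vec (M : Matrix (Fin n) (Fin m) ℝ) : EuclideanSpace ℝ (Fin n × Fin m) :=
  WithLp.toLp 2 fun ik => M ik.1 ik.2

@[simp]
theorem vec_sub (M N : Matrix (Fin n) (Fin m) ℝ) : vec (M - N) = vec M - vec N := rfl

theorem frobSq_eq_norm_vec (M : Matrix (Fin n) (Fin m) ℝ) : frobSq M = ‖vec M‖ ^ 2 := by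
  rw [frobSq_eq_sum, EuclideanSpace.real_norm_sq_eq, Fintype.sum_prod_type]
  rfl

/-- The matrices `X B` with `B` row-supported in `S`. -/
noncomputable def modelSpace (m : ℕ) (X : Matrix (Fin n) (Fin p) ℝ) (S : Finset (Fin p)) :
    Submodule ℝ (EuclideanSpace ℝ (Fin n × Fin m)) :=
  Submodule.span ℝ (Set.range fun jk : S × Fin m => vec (X * Matrix.single jk.1.1 jk.2 (1 : ℝ)))

theorem finrank_modelSpace_le (X : Matrix (Fin n) (Fin p) ℝ) (S : Finset (Fin p)) :
    Module.finrank ℝ (modelSpace m X S) ≤ S.card * m := by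
  exact (finrank_range_le_card _).trans_eq (by simp)

theorem vec_mul_mem_modelSpace (X : Matrix (Fin n) (Fin p) ℝ) {S : Finset (Fin p)}
    {B : Matrix (Fin p) (Fin m) ℝ} (hB : ∀ j ∉ S, B j = 0) : vec (X * B) ∈ modelSpace m X S := by
  have h : vec (X * B) =
      ∑ jk : S × Fin m, B jk.1 jk.2 • vec (X * Matrix.single jk.1.1 jk.2 (1 : ℝ)) := by
    ext ik
    simp only [vec, Matrix.mul_apply, PiLp.toLp_apply, WithLp.ofLp_sum, WithLp.ofLp_smul,
      Finset.sum_apply, Pi.smul_apply, Matrix.single_apply, smul_eq_mul, Fintype.sum_prod_type]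
    rw [← Finset.sum_subset (Finset.subset_univ S) fun j _ hj => by rw [hB j hj]; simp,
      ← Finset.sum_coe_sort]
    refine Finset.sum_congr rfl fun j _ => ?_
    simp [ite_and, mul_comm]
  rw [h]
  exact Submodule.sum_mem _ fun jk _ =>
    Submodule.smul_mem _ _ (Submodule.subset_span ⟨jk, rfl⟩)

/-- The row support of a matrix. -/
noncomputable def rowSupport (B : Matrix (Fin p) (Fin m) ℝ) : Finset (Fin p) :=
  (Set.toFinite {j : Fin p | B j ≠ 0}).toFinset

theorem card_rowSupport (B : Matrix (Fin p) (Fin m) ℝ) :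
    (rowSupport B).card = rowSupportCard B :=
  (Set.ncard_eq_toFinset_card _ _).symm

theorem eq_zero_of_notMem_rowSupport {B : Matrix (Fin p) (Fin m) ℝ} {j : Fin p}
    (hj : j ∉ rowSupport B) : B j = 0 := by
  simpa [rowSupport] using hj

theorem penalty_nonneg (B : Matrix (Fin p) (Fin m) ℝ) : 0 ≤ penalty B := by
  refine complexity_nonneg ?_
  rw [← card_rowSupport]
  exact card_finset_fin_le _

theorem complexity_card_union_le (B B' : Matrix (Fin p) (Fin m) ℝ) :
    complexity p m (rowSupport B ∪ rowSupport B').card ≤ penalty B + penalty B' := by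
  have h1 : (rowSupport B ∪ rowSupport B').card =
      (rowSupport B \ rowSupport B').card + (rowSupport B').card :=
    (Finset.card_sdiff_add_card _ _).symm
  have h2 := card_finset_fin_le (rowSupport B ∪ rowSupport B')
  rw [h1] at h2 ⊢
  refine (complexity_add_le h2).trans (add_le_add ?_ (by rw [card_rowSupport, penalty]))
  rw [penalty, ← card_rowSupport]
  exact complexity_mono (Finset.card_le_card Finset.sdiff_subset) (card_finset_fin_le _)

end Model

/-! ### The favourable noise event -/

theorem exists_noise_event {n m p : ℕ} (hp : 0 < p)
    (X : Matrix (Fin n) (Fin p) ℝ) {σ : ℝ} (hσ : 0 < σ) {κ : ℝ} (hκ : 0 < κ)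
    {Ω : Type*} [MeasurableSpace Ω] {μ : Measure Ω} [IsProbabilityMeasure μ]
    {E : Ω → Matrix (Fin n) (Fin m) ℝ}
    (hind : iIndepFun (fun (ik : Fin n × Fin m) (ω : Ω) => E ω ik.1 ik.2) μ)
    (hE : ∀ i k, IsSubGaussian μ (fun ω => E ω i k) σ)
    (hvar : ∀ i k, κ * σ ^ 2 ≤ ∫ ω, E ω i k ^ 2 ∂μ) :
    ∃ G : Set Ω, MeasurableSet G ∧
      1 - 2 * ((p : ℝ)⁻¹ * Real.exp (-m)) - Real.exp (-(m * n)) -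
        Real.exp (-(κ ^ 2 / 1024) * (m * n)) ≤ μ.real G ∧
      ∀ ω ∈ G, κ * σ ^ 2 * (m * n) / 2 < frobSq (E ω) ∧ frobSq (E ω) < 8 * σ ^ 2 * (m * n) ∧
        ∀ S : Finset (Fin p), ‖(modelSpace m X S).starProjection (vec (E ω))‖ ^ 2 ≤
          128 * σ ^ 2 * complexity p m S.card := by
  have hE' : ∀ ik : Fin n × Fin m, IsSubGaussian μ (fun ω => E ω ik.1 ik.2) σ :=
    fun ik => hE ik.1 ik.2
  have hcard : (Fintype.card (Fin n × Fin m) : ℝ) = m * n := by simp [mul_comm]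
  have hup := measure_sum_sq_ge_le hind hE' hσ
  have hlow := measure_sum_sq_le_le hind hE' hσ hκ fun ik => hvar ik.1 ik.2
  rw [hcard] at hup hlow
  have hsum : ∀ ω, ∑ ik : Fin n × Fin m, E ω ik.1 ik.2 ^ 2 = frobSq (E ω) := fun ω => by
    rw [frobSq_eq_sum, Fintype.sum_prod_type]
  simp_rw [hsum] at hup hlow
  have hmE : Measurable fun ω => vec (E ω) :=
    (WithLp.measurable_toLp 2 (Fin n × Fin m → ℝ)).comp
      (measurable_pi_lambda _ fun ik => (hE' ik).measurable)
  have hmF : Measurable fun ω => frobSq (E ω) := by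
    simp_rw [frobSq_eq_norm_vec]
    fun_prop
  let U : Set Ω := {ω | 8 * σ ^ 2 * (m * n) ≤ frobSq (E ω)}
  let L : Set Ω := {ω | frobSq (E ω) ≤ κ * σ ^ 2 * (m * n) / 2}
  -- The empty support has zero complexity and would cost probability $1$ in the union bound; its
  -- model space is trivial, so nothing is excluded there.
  let Q : Finset (Fin p) → Set Ω := fun S => if S.card = 0 then ∅ else
    {ω | 32 * σ ^ 2 * (4 * complexity p m S.card) ≤
      ‖(modelSpace m X S).starProjection (vec (E ω))‖ ^ 2}
  have hmU : MeasurableSet U := measurableSet_le measurable_const hmF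
  have hmL : MeasurableSet L := measurableSet_le hmF measurable_const
  have hmQ : ∀ S, MeasurableSet (Q S) := fun S => by
    simp only [Q]
    split_ifs
    · exact MeasurableSet.empty
    · exact measurableSet_le measurable_const
        ((((modelSpace m X S).starProjection.continuous.measurable.comp hmE).norm).pow_const 2)
  have hQ : ∀ S, μ.real (Q S) ≤
      if S.card = 0 then 0 else Real.exp (-3 * complexity p m S.card) := fun S => by
    simp only [Q]
    split_ifs
    · simp
    · refine ENNReal.toReal_le_of_le_ofReal (Real.exp_pos _).le
        ((measure_norm_sq_projection_ge_le hind hE' hσ (modelSpace m X S) _).trans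
          (ENNReal.ofReal_le_ofReal (Real.exp_le_exp.2 ?_)))
      -- The dimension is at most the complexity, so $\dim/2-4P\le-3P$.
      have h1 : (Module.finrank ℝ (modelSpace m X S) : ℝ) ≤ S.card * m := by
        exact_mod_cast finrank_modelSpace_le X S
      have h2 := mul_le_complexity (m := m) (card_finset_fin_le S)
      have h3 := complexity_nonneg (m := m) (card_finset_fin_le S)
      linarith
  refine ⟨(U ∪ L ∪ ⋃ S, Q S)ᶜ, ((hmU.union hmL).union (MeasurableSet.iUnion hmQ)).compl, ?_, ?_⟩
  · rw [probReal_compl_eq_one_sub ((hmU.union hmL).union (MeasurableSet.iUnion hmQ))]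
    have h1 := measureReal_union_le (μ := μ) (U ∪ L) (⋃ S, Q S)
    have h2 := measureReal_union_le (μ := μ) U L
    have h3 : μ.real (⋃ S, Q S) ≤ 2 * ((p : ℝ)⁻¹ * Real.exp (-m)) :=
      (measureReal_iUnion_fintype_le Q).trans
        ((Finset.sum_le_sum fun S _ => hQ S).trans (sum_exp_complexity_le hp))
    have h4 : μ.real U ≤ Real.exp (-(m * n)) :=
      ENNReal.toReal_le_of_le_ofReal (Real.exp_pos _).le hup
    have h5 : μ.real L ≤ Real.exp (-(κ ^ 2 / 1024) * (m * n)) :=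
      ENNReal.toReal_le_of_le_ofReal (Real.exp_pos _).le hlow
    linarith
  · intro ω hω
    simp only [Set.mem_compl_iff, Set.mem_union, Set.mem_iUnion, not_or, not_exists] at hω
    obtain ⟨⟨hU, hL⟩, hS⟩ := hω
    refine ⟨not_le.1 hL, not_le.1 hU, fun S => ?_⟩
    by_cases h0 : S.card = 0
    · have h1 : modelSpace m X S = ⊥ := by
        have := finrank_modelSpace_le (m := m) X S
        rw [h0, zero_mul] at this
        exact Submodule.finrank_eq_zero.1 (Nat.le_zero.1 this)
      rw [h1, h0]
      simp
    · have h1 := hS S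
      simp only [Q, if_neg h0, Set.mem_ofPred_eq, not_le] at h1
      linarith

/-! ### The deterministic comparison -/

theorem exp_sub_le {a b : ℝ} (ha : 0 ≤ a) (ha1 : a ≤ 1) (hb : 0 ≤ b) (hb1 : b ≤ 1) :
    Real.exp (a - b) ≤ 1 + (2 * a - b / 2) := by
  rcases le_total b a with h | h
  · have := (abs_le.1 (Real.abs_exp_sub_one_sub_id_le (x := a - b)
      (abs_le.2 ⟨by linarith, by linarith⟩))).2
    nlinarith
  · have h1 := exp_mul_le_of_mem_Icc (θ := b - a) (by linarith) (by linarith) (-1)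
    have h2 : Real.exp (-1) ≤ 1 / 2 := by
      rw [Real.exp_neg, one_div]
      have := Real.add_one_le_exp 1
      gcongr
      linarith
    rw [mul_neg_one, neg_sub] at h1
    nlinarith

theorem IsSelected.frobSq_le {A : ℝ} {n p m : ℕ} {X : Matrix (Fin n) (Fin p) ℝ}
    {Y : Matrix (Fin n) (Fin m) ℝ} {Bhat B : Matrix (Fin p) (Fin m) ℝ}
    (h : IsSelected A X Y Bhat) (hB : scaledPenalty A n B < 1) (hpos : 0 < frobSq (X * B - Y)) :
    frobSq (X * Bhat - Y) ≤
      frobSq (X * B - Y) * Real.exp (scaledPenalty A n B - scaledPenalty A n Bhat) := by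
  -- A perfect fit has criterion $-\infty$, but then the claimed bound is trivial.
  rcases le_or_gt (frobSq (X * Bhat - Y)) 0 with h0 | h0
  · exact h0.trans (by positivity)
  have h1 : logCriterion A X Y Bhat ≤ logCriterion A X Y B := h.2 hB
  rw [logCriterion, logCriterion, ENNReal.log_ofReal_of_pos h0, ENNReal.log_ofReal_of_pos hpos,
    ← EReal.coe_add, ← EReal.coe_add, EReal.coe_le_coe_iff] at h1
  rw [← Real.log_le_log_iff h0 (by positivity), Real.log_mul hpos.ne' (Real.exp_pos _).ne',
    Real.log_exp]
  linarith

open scoped RealInnerProductSpace in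
-- Since $d\in V$, $\langle d,e\rangle=\langle d,P_Ve\rangle$; then
-- $2\|d\|\|P_Ve\|\le\|d\|^2/2+2\|P_Ve\|^2$ absorbs half of $\|d\|^2$.
theorem norm_sq_le_of_norm_sub_sq_le {F : Type*} [NormedAddCommGroup F] [InnerProductSpace ℝ F]
    (V : Submodule ℝ F) [V.HasOrthogonalProjection] {d e : F} (hd : d ∈ V) {r : ℝ}
    (h : ‖d - e‖ ^ 2 ≤ ‖e‖ ^ 2 * (1 + r)) :
    ‖d‖ ^ 2 / 2 ≤ 2 * ‖V.starProjection e‖ ^ 2 + ‖e‖ ^ 2 * r := by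
  have h1 : ⟪d, e⟫ ≤ ‖d‖ * ‖V.starProjection e‖ := by
    have := V.inner_starProjection_left_eq_right d e
    rw [Submodule.starProjection_eq_self_iff.2 hd] at this
    rw [this]
    exact real_inner_le_norm _ _
  rw [norm_sub_sq_real] at h
  nlinarith [sq_nonneg (‖d‖ - 2 * ‖V.starProjection e‖)]

/-- The prediction error bound, for a given realization of the noise. -/
theorem IsSelected.D₂_le {κ σ A : ℝ} {n m p : ℕ} (hn : 0 < n) (hm : 0 < m) (hκ : 0 < κ)
    (hσ : 0 < σ) (hA : 1024 / κ ≤ A) {X : Matrix (Fin n) (Fin p) ℝ}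
    {Bstar Bhat : Matrix (Fin p) (Fin m) ℝ} {E : Matrix (Fin n) (Fin m) ℝ}
    (hstar : scaledPenalty A n Bstar < 1) (hlow : κ * σ ^ 2 * (m * n) / 2 < frobSq E)
    (hup : frobSq E < 8 * σ ^ 2 * (m * n))
    (hproj : ∀ S : Finset (Fin p), ‖(modelSpace m X S).starProjection (vec E)‖ ^ 2 ≤
      128 * σ ^ 2 * complexity p m S.card)
    (h : IsSelected A X (X * Bstar + E) Bhat) :
    D₂ (X * Bhat) (X * Bstar) ≤ (256 + 16 * A) * σ ^ 2 * penalty Bstar := by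
  have hmn : (0 : ℝ) < m * n := by positivity
  have hA0 : 0 < A := lt_of_lt_of_le (by positivity) hA
  have hEpos : 0 < frobSq E := lt_trans (by positivity) hlow
  have e1 : frobSq (X * Bstar - (X * Bstar + E)) = frobSq E := by
    rw [frobSq_eq_sum, frobSq_eq_sum]
    simp
  have h1 := h.frobSq_le hstar (by rwa [e1])
  have hP := penalty_nonneg Bstar
  have hPh := penalty_nonneg Bhat
  have hd : 0 ≤ scaledPenalty A n Bstar := by unfold scaledPenalty; positivity
  have hdh : 0 ≤ scaledPenalty A n Bhat := by unfold scaledPenalty; positivity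
  rw [e1] at h1
  have h2 := h1.trans (mul_le_mul_of_nonneg_left (exp_sub_le hd hstar.le hdh h.1.le) hEpos.le)
  rw [← sub_sub, frobSq_eq_norm_vec, frobSq_eq_norm_vec, vec_sub, ← Matrix.mul_sub] at h2
  have hmem : vec (X * (Bhat - Bstar)) ∈ modelSpace m X (rowSupport Bhat ∪ rowSupport Bstar) := by
    refine vec_mul_mem_modelSpace X fun j hj => ?_
    rw [Finset.notMem_union] at hj
    have : (Bhat - Bstar) j = Bhat j - Bstar j := rfl
    rw [this, eq_zero_of_notMem_rowSupport hj.1, eq_zero_of_notMem_rowSupport hj.2, sub_zero]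
  have h3 := norm_sq_le_of_norm_sub_sq_le _ hmem h2
  rw [← frobSq_eq_norm_vec, ← frobSq_eq_norm_vec, Matrix.mul_sub] at h3
  have h4 := hproj (rowSupport Bhat ∪ rowSupport Bstar)
  have h5 : 128 * σ ^ 2 * complexity p m (rowSupport Bhat ∪ rowSupport Bstar).card ≤
      128 * σ ^ 2 * (penalty Bhat + penalty Bstar) := by
    gcongr
    exact complexity_card_union_le _ _
  have h6 : frobSq E * scaledPenalty A n Bstar ≤ 8 * σ ^ 2 * (A * penalty Bstar) := by
    calc _ ≤ 8 * σ ^ 2 * (m * n) * scaledPenalty A n Bstar := by gcongr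
      _ = _ := by unfold scaledPenalty; field_simp
  -- Half of this gain cancels the $256\sigma^2\hat P$ coming from the projection; this fixes the
  -- threshold $1024/\kappa$.
  have h7 : σ ^ 2 * (512 * penalty Bhat) ≤ frobSq E * scaledPenalty A n Bhat := by
    calc _ ≤ σ ^ 2 * (κ * A / 2 * penalty Bhat) := by
          have : 1024 ≤ κ * A := by rwa [div_le_iff₀' hκ] at hA
          gcongr
          linarith
      _ = κ * σ ^ 2 * (m * n) / 2 * scaledPenalty A n Bhat := by unfold scaledPenalty; field_simp
      _ ≤ _ := by gcongr
  unfold D₂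
  linarith

end PredictiveIC

theorem mainTheorem10 :
    -- `κ` is the constant in the lower bound `E ε² ≥ κ σ²` on the noise variances
    ∀ κ : ℝ, 0 < κ →
    ∃ Amin C c : ℝ, 0 < Amin ∧ 0 < C ∧ 0 < c ∧
    ∀ A A₀ : ℝ, Amin ≤ A → A < A₀ →
    ∃ K : ℝ, 0 < K ∧
    ∀ (n m p : ℕ), 0 < n → 0 < m → 0 < p →
    ∀ (X : Matrix (Fin n) (Fin p) ℝ) (Bstar : Matrix (Fin p) (Fin m) ℝ) (σ : ℝ), 0 < σ →
    ∀ (Ω : Type*) [MeasurableSpace Ω] (μ : MeasureTheory.Measure Ω)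
      [MeasureTheory.IsProbabilityMeasure μ] (E : Ω → Matrix (Fin n) (Fin m) ℝ),
      -- independent centered sub-Gaussian entries with non-degenerate variances
      ProbabilityTheory.iIndepFun (fun (ik : Fin n × Fin m) (ω : Ω) => E ω ik.1 ik.2) μ →
      (∀ i k, PredictiveIC.IsSubGaussian μ (fun ω => E ω i k) σ) →
      (∀ i k, κ * σ ^ 2 ≤ ∫ ω, E ω i k ^ 2 ∂μ) →
      -- model parsimony
      PredictiveIC.penalty Bstar ≤ (m : ℝ) * n / A₀ →
      ∃ G : Set Ω, MeasurableSet G ∧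
        1 - C * (p : ℝ) ^ (-c) * Real.exp (-c * m) - C * Real.exp (-c * (m * n)) ≤ μ.real G ∧
        ∀ ω ∈ G, ∀ Bhat : Matrix (Fin p) (Fin m) ℝ,
          PredictiveIC.IsSelected A X (X * Bstar + E ω) Bhat →
          PredictiveIC.D₂ (X * Bhat) (X * Bstar) ≤
            K * σ ^ 2 *
              ((PredictiveIC.rowSupportCard Bstar : ℝ) * m +
                PredictiveIC.rowSupportCard Bstar *
                  Real.log (Real.exp 1 * p / PredictiveIC.rowSupportCard Bstar)) := by
  intro κ hκ
  have hc : 0 < min 1 (κ ^ 2 / 1024) := lt_min one_pos (by positivity)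
  refine ⟨1024 / κ, 2, min 1 (κ ^ 2 / 1024), by positivity, two_pos, hc, fun A A₀ hA hA₀ => ?_⟩
  have hA0 : 0 < A := lt_of_lt_of_le (by positivity) hA
  refine ⟨256 + 16 * A, by positivity, ?_⟩
  intro n m p hn hm hp X Bstar σ hσ Ω _ μ _ E hind hE hvar hpen
  obtain ⟨G, hG, hprob, hbound⟩ :=
    PredictiveIC.exists_noise_event hp X hσ hκ hind hE hvar
  refine ⟨G, hG, le_trans ?_ hprob, fun ω hω Bhat hsel => ?_⟩
  · set c := min 1 (κ ^ 2 / 1024)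
    have hc1 : c ≤ 1 := min_le_left _ _
    have hc2 : c ≤ κ ^ 2 / 1024 := min_le_right _ _
    have hp1 : (1 : ℝ) ≤ p := by exact_mod_cast hp
    have h1 : (p : ℝ)⁻¹ * Real.exp (-m) ≤ (p : ℝ) ^ (-c) * Real.exp (-c * m) := by
      rw [← Real.rpow_neg_one]
      gcongr
      nlinarith [(Nat.cast_nonneg m : (0 : ℝ) ≤ m)]
    have hmn : (0 : ℝ) ≤ m * n := by positivity
    have h2 : Real.exp (-(m * n)) ≤ Real.exp (-c * (m * n)) :=
      Real.exp_le_exp.2 (by nlinarith)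
    have h3 : Real.exp (-(κ ^ 2 / 1024) * (m * n)) ≤ Real.exp (-c * (m * n)) := by
      gcongr
    linarith
  · obtain ⟨hlow, hup, hproj⟩ := hbound ω hω
    refine hsel.D₂_le hn hm hκ hσ hA ?_ hlow hup hproj
    have hmn : (0 : ℝ) < m * n := by positivity
    rw [PredictiveIC.scaledPenalty, div_lt_one hmn]
    have hA₀' : 0 < A₀ := hA0.trans hA₀
    rw [le_div_iff₀ hA₀'] at hpen
    -- Strictness in $AP^*<mn$ comes from $A<A_0$ when $P^*>0$, and from $mn>0$ when $P^*=0$.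
    rcases (PredictiveIC.penalty_nonneg Bstar).eq_or_lt with h0 | h0
    · rw [← h0, mul_zero]
      exact hmn
    · nlinarith
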